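/- Let $G$ be Hall's universal locally finite group, i.e. the Fraïssé limit of the class of finite groups: a countable locally finite group into which every finite group embeds, and such that for all finite groups $A, B$ and all embeddings $\rho: A\to G$ and $\iota: A\to B$ there is an embedding $\sigma: B\to G$ with $\sigma\circ\iota=\rho$. Let $\mathbb{U}$ be the Urysohn universal metric space, i.e. the completion of the rational Urysohn space, where the latter is the Fraïssé limit (in the same sense, with isometric embeddings) of the class of finite metric spaces with rational distances. Let $\mathrm{Iso}(\mathbb{U})$ be the group of all surjective isometries of $\mathbb{U}$ with the topology of pointwise convergence, and let $\mathrm{Hom}(G,\mathrm{Iso}(\mathbb{U}))$ be the space of all group homomorphisms $G\to\mathrm{Iso}(\mathbb{U})$ with the topology inherited from the product space $\mathrm{Iso}(\mathbb{U})^G$. Then there exists a Polish group $\mathbb{H}$ (a topological group whose topology is second countable and completely metrizable) such that the set of those $\alpha\in\mathrm{Hom}(G,\mathrm{Iso}(\mathbb{U}))$ for which the closure $\overline{\alpha[G]}$ of the image in $\mathrm{Iso}(\mathbb{U})$ is isomorphic, as a topological group, to $\mathbb{H}$ is comeager in $\mathrm{Hom}(G,\mathrm{Iso}(\mathbb{U}))$.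 -/

import Mathlib

universe u v

/-- Hall's universal locally finite group, as the Fraïssé limit of the class of finite groups:
a countable locally finite group (equivalently, a direct limit of a sequence of finite groups)
into which every finite group embeds and which has the extension property with respect to
embeddings of finite groups. These properties determine the group up to isomorphism. -/
structure IsHallGroup (G : Type u) [Group G] : Prop where
  countable : Countable G
  locallyFinite : ∀ H : Subgroup G, H.FG → Finite H
  universal : ∀ (A : Type u) [Group A] [Finite A], ∃ ρ : A →* G, Function.Injective ρ
  extension : ∀ (A B : Type u) [Group A] [Group B] [Finite A] [Finite B]
    (ρ : A →* G) (ι : A →* B), Function.Injective ρ → Function.Injective ι →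
      ∃ σ : B →* G, Function.Injective σ ∧ σ.comp ι = ρ

/-- All distances of the metric space `X` are rational. -/
def HasRationalDistances (X : Type*) [MetricSpace X] : Prop :=
  ∀ x y : X, ∃ r : ℚ, dist x y = (r : ℝ)

/-- The rational Urysohn space, as the Fraïssé limit of the class of finite metric spaces with
rational distances: a countable metric space with rational distances (equivalently, the union of
an increasing sequence of finite ones) into which every finite metric space with rational
distances embeds isometrically and which has the extension property with respect to isometric
embeddings of such spaces. These properties determine the space up to isometry. -/
structure IsRationalUrysohn (X : Type u) [MetricSpace X] : Prop where
  countable : Countable X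
  rational : HasRationalDistances X
  universal : ∀ (A : Type u) [MetricSpace A] [Finite A], HasRationalDistances A →
    ∃ ρ : A → X, Isometry ρ
  extension : ∀ (A B : Type u) [MetricSpace A] [MetricSpace B] [Finite A] [Finite B],
    HasRationalDistances A → HasRationalDistances B →
    ∀ (ρ : A → X) (ι : A → B), Isometry ρ → Isometry ι →
      ∃ σ : B → X, Isometry σ ∧ σ ∘ ι = ρ

/-- The Urysohn universal metric space: `U` is a completion of the rational Urysohn space, that
is, `U` is complete and has a dense subspace which is a rational Urysohn space. -/
structure IsUrysohnSpace (U : Type*) [MetricSpace U] : Prop where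
  complete : CompleteSpace U
  dense_rational : ∃ Q : Set U, Dense Q ∧ IsRationalUrysohn Q

/-- The topology of pointwise convergence on the group `X ≃ᵢ X` of all (surjective) isometries
of `X`. -/
instance isoTopology (X : Type*) [PseudoMetricSpace X] : TopologicalSpace (X ≃ᵢ X) :=
  TopologicalSpace.induced (fun φ : X ≃ᵢ X => (φ : X → X)) inferInstance

theorem continuous_iso_apply {X : Type*} [PseudoMetricSpace X] (x : X) :
    Continuous (fun φ : X ≃ᵢ X => φ x) :=
  (continuous_apply x).comp continuous_induced_dom

theorem continuous_iso_rng {X Y : Type*} [PseudoMetricSpace X] [TopologicalSpace Y]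
    {f : Y → (X ≃ᵢ X)} (h : ∀ x, Continuous (fun y => f y x)) : Continuous f :=
  continuous_induced_rng.2 (continuous_pi h)

instance isoTopologicalGroup (X : Type*) [PseudoMetricSpace X] :
    IsTopologicalGroup (X ≃ᵢ X) where
  continuous_mul := by
    refine continuous_iso_rng fun x => continuous_iff_continuousAt.2 fun p => ?_
    change Filter.Tendsto (fun q : (X ≃ᵢ X) × (X ≃ᵢ X) => q.1 (q.2 x)) (nhds p)
      (nhds (p.1 (p.2 x)))
    rw [tendsto_iff_dist_tendsto_zero]
    have h1 : Filter.Tendsto (fun q : (X ≃ᵢ X) × (X ≃ᵢ X) => dist (q.2 x) (p.2 x)) (nhds p)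
        (nhds 0) :=
      tendsto_iff_dist_tendsto_zero.1 (((continuous_iso_apply x).comp continuous_snd).tendsto p)
    have h2 : Filter.Tendsto (fun q : (X ≃ᵢ X) × (X ≃ᵢ X) =>
        dist (q.1 (p.2 x)) (p.1 (p.2 x))) (nhds p) (nhds 0) :=
      tendsto_iff_dist_tendsto_zero.1
        (((continuous_iso_apply (p.2 x)).comp continuous_fst).tendsto p)
    have h3 := h1.add h2
    rw [add_zero] at h3
    refine squeeze_zero (fun _ => dist_nonneg) (fun q => ?_) h3
    rw [← q.1.isometry.dist_eq (q.2 x) (p.2 x)]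
    exact dist_triangle _ _ _
  continuous_inv := by
    refine continuous_iso_rng fun x => continuous_iff_continuousAt.2 fun p => ?_
    change Filter.Tendsto (fun q : X ≃ᵢ X => q.symm x) (nhds p) (nhds (p.symm x))
    rw [tendsto_iff_dist_tendsto_zero]
    have h := tendsto_iff_dist_tendsto_zero.1 ((continuous_iso_apply (p.symm x)).tendsto p)
    refine h.congr fun q => ?_
    rw [← q.isometry.dist_eq (q.symm x) (p.symm x), q.apply_symm_apply, p.apply_symm_apply,
      dist_comm]

/-- The topology on the set `Hom(G, M)` of all homomorphisms from a (discrete) group `G` to a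
topological group `M`, as a subspace of the product space `M ^ G`. -/
instance homTopology (G M : Type*) [Group G] [Group M] [TopologicalSpace M] :
    TopologicalSpace (G →* M) :=
  TopologicalSpace.induced (fun f : G →* M => (f : G → M)) inferInstance

/-!
The generic `α` has dense range, so that the closure of its image is the whole isometry group of
`U`, which is Polish. By second countability it suffices to show that a homomorphism `α₀` can be
perturbed so that its range meets a given nonempty open set. As `G` is locally finite, this means:
for a finite subgroup `F` of `G`, an isometric action `θ` of `F` on `U`, an isometry `φ` and a
finite set `P ⊆ U`, some action of `G` approximates on `P` both `θ`, on `F`, and `φ`, at one element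
of `G`.

Let `Θ` be the action of the free group on `F` and one more letter given by `θ` and `φ`. Restricting
`θ` to a large finite `F`-invariant subset of `U`, and completing the restriction of `φ` to a
permutation of it, one obtains a finite group containing `F`. It embeds into `G` over `F`, which
yields a homomorphism `Ψ` from the free group to `G` such that no short word in the kernel of `Ψ`
moves a point of `P`. Take the pseudometric of the orbits of `P` under `Θ`, add a small multiple of
the word length, truncate it at a large constant and push it forward along `Ψ`. Only short words
stay below the truncation, so the resulting invariant pseudometric on `G × P` almost agrees with
the distances in `U`.

It remains to extend an invariant pseudometric to an action on `U`. Among the invariant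
pseudometrics on `G × ι`, with `ι` infinite, those with the approximate extension property of
Katětov are generic: a Katětov function can be realized by replacing a single, far away orbit. The
completion of such a space is isometric to `U` by a back-and-forth argument, and the isometry can be
chosen to nearly match any two finite families whose distances nearly agree.
-/

section Katetov

variable {ι κ X : Type*} [PseudoMetricSpace X]

/-- `f` is a Katětov function on the family `a`: the values `f i` are admissible distances from
a (possibly new) point to the points `a i`. -/
structure IsKatetov (a : ι → X) (f : ι → ℝ) : Prop where
  sub_le_dist : ∀ i j, f i - f j ≤ dist (a i) (a j)
  dist_le_add : ∀ i j, dist (a i) (a j) ≤ f i + f j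

namespace IsKatetov

variable {a : ι → X} {f : ι → ℝ}

theorem nonneg (h : IsKatetov a f) (i : ι) : 0 ≤ f i := by
  have := h.dist_le_add i i
  rw [dist_self] at this
  linarith

theorem comp (h : IsKatetov a f) (e : κ → ι) : IsKatetov (a ∘ e) (f ∘ e) :=
  ⟨fun i j => h.sub_le_dist (e i) (e j), fun i j => h.dist_le_add (e i) (e j)⟩

theorem of_nonempty (h : Nonempty ι → IsKatetov a f) : IsKatetov a f :=
  ⟨fun i => (h ⟨i⟩).sub_le_dist i, fun i => (h ⟨i⟩).dist_le_add i⟩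

theorem abs_sub_le_add {g : ι → ℝ} (hf : IsKatetov a f) (hg : IsKatetov a g) (i j : ι) :
    |f i - g i| ≤ f j + g j := by
  have := hf.sub_le_dist i j
  have := hg.dist_le_add i j
  have := hg.sub_le_dist i j
  have := hf.dist_le_add i j
  rw [abs_sub_le_iff]
  constructor <;> linarith

end IsKatetov

theorem isKatetov_dist (x : X) : IsKatetov id (dist x) where
  sub_le_dist y z := sub_le_iff_le_add'.2 (dist_comm z y ▸ dist_triangle x z y)
  dist_le_add y z := dist_triangle_left y z x

/-- The largest `1`-Lipschitz function on `X` which is at most `f i` at each of the points `a i`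
of a finite family; it extends `f` whenever `f` is a Katětov function on `a`. -/
noncomputable def katetovHull (a : ι → X) (f : ι → ℝ) (x : X) : ℝ :=
  ⨅ i, f i + dist x (a i)

theorem sub_le_katetovHull (a : ι → X) (f : ι → ℝ) {δ : ℝ} (i : ι)
    (h : ∀ j, f i - f j ≤ dist (a i) (a j) + δ) : f i - δ ≤ katetovHull a f (a i) :=
  have : Nonempty ι := ⟨i⟩
  le_ciInf fun j => by linarith [h j]

variable [Finite ι] (a : ι → X) (f : ι → ℝ)

theorem katetovHull_le (x : X) (i : ι) : katetovHull a f x ≤ f i + dist x (a i) :=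
  ciInf_le (Set.finite_range _).bddBelow i

theorem katetovHull_apply_le (i : ι) : katetovHull a f (a i) ≤ f i := by
  simpa using katetovHull_le a f (a i) i

theorem exists_katetovHull_eq [Nonempty ι] (x : X) :
    ∃ i, katetovHull a f x = f i + dist x (a i) :=
  let ⟨i, hi⟩ := exists_eq_ciInf_of_finite (f := fun i => f i + dist x (a i))
  ⟨i, hi.symm⟩

variable {a f} in
theorem isKatetov_katetovHull [Nonempty ι] (h : ∀ i j, dist (a i) (a j) ≤ f i + f j) :
    IsKatetov id (katetovHull a f) where
  sub_le_dist x y := by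
    obtain ⟨j, hj⟩ := exists_katetovHull_eq a f y
    have := katetovHull_le a f x j
    have := dist_triangle x y (a j)
    simp only [id]
    linarith
  dist_le_add x y := by
    obtain ⟨i, hi⟩ := exists_katetovHull_eq a f x
    obtain ⟨j, hj⟩ := exists_katetovHull_eq a f y
    have htriangle := dist_triangle4 x (a i) (a j) y
    have := h i j
    rw [dist_comm (a j)] at htriangle
    simp only [id]
    linarith

end Katetov

section ExtensionProperty

variable {X : Type*} [PseudoMetricSpace X]

/-- Every Katětov function on a finite family in `X` is approximately realized by the distances
to a point of `X`. -/
def HasApproxExtensionProperty (X : Type*) [PseudoMetricSpace X] : Prop :=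
  ∀ (n : ℕ) (a : Fin n → X) (f : Fin n → ℝ), IsKatetov a f →
    ∀ ε > 0, ∃ z, ∀ i, |dist z (a i) - f i| ≤ ε

/-- Every Katětov function on a finite family in `X` is realized by the distances to a point
of `X`. -/
def HasExtensionProperty (X : Type*) [PseudoMetricSpace X] : Prop :=
  ∀ (n : ℕ) (a : Fin n → X) (f : Fin n → ℝ), IsKatetov a f → ∃ z, ∀ i, dist z (a i) = f i

theorem HasApproxExtensionProperty.exists_of_finite (hX : HasApproxExtensionProperty X)
    {ι : Type*} [Finite ι] {a : ι → X} {f : ι → ℝ} (h : IsKatetov a f) {ε : ℝ} (hε : 0 < ε) :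
    ∃ z, ∀ i, |dist z (a i) - f i| ≤ ε := by
  obtain ⟨n, ⟨e⟩⟩ := Finite.exists_equiv_fin ι
  obtain ⟨z, hz⟩ := hX n _ _ (h.comp e.symm) ε hε
  exact ⟨z, fun i => by simpa using hz (e i)⟩

theorem HasExtensionProperty.exists_of_finite (hX : HasExtensionProperty X)
    {ι : Type*} [Finite ι] {a : ι → X} {f : ι → ℝ} (h : IsKatetov a f) :
    ∃ z, ∀ i, dist z (a i) = f i := by
  obtain ⟨n, ⟨e⟩⟩ := Finite.exists_equiv_fin ι
  obtain ⟨z, hz⟩ := hX n _ _ (h.comp e.symm)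
  exact ⟨z, fun i => by simpa using hz (e i)⟩

theorem HasExtensionProperty.nonempty (hX : HasExtensionProperty X) : Nonempty X :=
  let ⟨z, _⟩ := hX 0 Fin.elim0 Fin.elim0 ⟨fun i => i.elim0, fun i => i.elim0⟩
  ⟨z⟩

theorem HasApproxExtensionProperty.of_denseRange {V : Type*} [PseudoMetricSpace V]
    (hX : HasApproxExtensionProperty X) {q : X → V} (hq : Isometry q) (hqd : DenseRange q) :
    HasApproxExtensionProperty V := by
  intro n a f hf ε hε
  have hη : 0 < ε / 3 := by positivity
  choose b hb using fun i => hqd.exists_dist_lt (a i) hη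
  have hdist : ∀ i j, |dist (b i) (b j) - dist (a i) (a j)| ≤ 2 * (ε / 3) := fun i j => by
    rw [← hq.dist_eq, ← Real.dist_eq, two_mul]
    exact (dist_dist_dist_le ..).trans
      (add_le_add (dist_comm (a i) _ ▸ (hb i).le) (dist_comm (a j) _ ▸ (hb j).le))
  -- Raising `f` by `ε / 3` makes it large enough for its hull on `b` to be a Katětov function.
  let g : Fin n → ℝ := fun i => f i + ε / 3
  have hg : IsKatetov b (katetovHull b g ∘ b) := .of_nonempty fun _ =>
    (isKatetov_katetovHull fun i j => by
      linarith [show g i = f i + ε / 3 from rfl, show g j = f j + ε / 3 from rfl,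
        hf.dist_le_add i j, (abs_le.1 (hdist i j)).2]).comp b
  have hg_ge : ∀ i, f i + ε / 3 - 2 * (ε / 3) ≤ katetovHull b g (b i) := fun i =>
    sub_le_katetovHull b g i fun j => by
      linarith [show g i = f i + ε / 3 from rfl, show g j = f j + ε / 3 from rfl,
        hf.sub_le_dist i j, (abs_le.1 (hdist i j)).1]
  have hg_le : ∀ i, katetovHull b g (b i) ≤ f i + ε / 3 := katetovHull_apply_le b g
  obtain ⟨z, hz⟩ := hX n b _ hg (ε / 3) hη
  refine ⟨q z, fun i => ?_⟩
  have hza : |dist (q z) (a i) - dist z (b i)| ≤ ε / 3 := by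
    rw [← hq.dist_eq z, ← Real.dist_eq]
    exact (dist_dist_dist_le_right ..).trans (hb i).le
  have := abs_le.1 (hz i)
  have := abs_le.1 hza
  simp only [Function.comp] at *
  rw [abs_le]
  constructor <;> linarith [hg_ge i, hg_le i]

theorem HasApproxExtensionProperty.exists_improvement (hX : HasApproxExtensionProperty X)
    {ι : Type*} [Finite ι] {a : ι → X} {f : ι → ℝ} (hf : IsKatetov a f) {z : X} {δ η : ℝ}
    (hδ : 0 ≤ δ) (hz : ∀ i, |dist z (a i) - f i| ≤ δ) (hη : 0 < η) :
    ∃ z', dist z z' ≤ δ + η ∧ ∀ i, |dist z' (a i) - f i| ≤ η := by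
  have hza : ∀ i, f i - δ ≤ dist z (a i) ∧ dist z (a i) ≤ δ + f i := fun i => by
    have := abs_le.1 (hz i)
    constructor <;> linarith
  let b : Option ι → X := fun o => o.elim z a
  let g : Option ι → ℝ := fun o => o.elim δ f
  have hg : IsKatetov b (katetovHull b g ∘ b) := by
    refine (isKatetov_katetovHull ?_).comp b
    rintro (_ | i) (_ | j)
    · exact (dist_self z).trans_le (add_nonneg hδ hδ)
    · exact (hza j).2
    · exact (dist_comm (a i) z).trans_le ((hza i).2.trans_eq (add_comm _ _))
    · exact hf.dist_le_add i j
  have hgz : katetovHull b g z ≤ δ := katetovHull_apply_le b g none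
  have hga : ∀ i, katetovHull b g (a i) = f i := fun i => by
    refine le_antisymm (katetovHull_apply_le b g (some i)) ?_
    refine (sub_zero (f i)).symm.trans_le (sub_le_katetovHull b g (some i) ?_)
    rintro (_ | j)
    · exact (hza i).1.trans_eq ((dist_comm _ _).trans (add_zero _).symm)
    · exact (hf.sub_le_dist i j).trans_eq (add_zero _).symm
  obtain ⟨z', hz'⟩ := hX.exists_of_finite hg hη
  refine ⟨z', ?_, fun i => hga i ▸ hz' (some i)⟩
  have : dist z' z - katetovHull b g z ≤ η := (abs_le.1 (hz' none)).2
  rw [dist_comm]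
  linarith

theorem HasApproxExtensionProperty.hasExtensionProperty [CompleteSpace X]
    (hX : HasApproxExtensionProperty X) : HasExtensionProperty X := by
  intro n a f hf
  let P : ℕ → Type _ := fun k => {z : X // ∀ i, |dist z (a i) - f i| ≤ (1 / 2 : ℝ) ^ k}
  have exists_next : ∀ k (z : P k), ∃ z' : P (k + 1), dist z.1 z'.1 ≤ 4 / 2 / 2 ^ k :=
      fun k z => by
    obtain ⟨z', hdist, hz'⟩ := hX.exists_improvement hf (by positivity) z.2
      (show (0 : ℝ) < (1 / 2) ^ (k + 1) by positivity)
    refine ⟨⟨z', hz'⟩, hdist.trans ?_⟩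
    have : (0 : ℝ) < (1 / 2) ^ k := by positivity
    rw [pow_succ, div_eq_mul_inv (4 / 2 : ℝ), ← inv_pow, ← one_div (2 : ℝ)]
    linarith
  choose next hnext using exists_next
  obtain ⟨z₀, hz₀⟩ := hX n a f hf 1 one_pos
  let z : ∀ k, P k := fun k => Nat.rec ⟨z₀, by simpa using hz₀⟩ next k
  have hz : ∀ k, dist (z k).1 (z (k + 1)).1 ≤ 4 / 2 / 2 ^ k := fun k => hnext k (z k)
  obtain ⟨w, hw⟩ := cauchySeq_tendsto_of_complete (cauchySeq_of_le_geometric_two hz)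
  refine ⟨w, fun i => tendsto_nhds_unique (hw.dist tendsto_const_nhds) ?_⟩
  exact tendsto_iff_dist_tendsto_zero.2 <| squeeze_zero (fun _ => dist_nonneg)
    (fun k => (z k).2 i) (tendsto_pow_atTop_nhds_zero_of_lt_one (by norm_num) (by norm_num))

end ExtensionProperty

section UrysohnSpace

/-- The one-point extension of a metric space by a strictly positive Katětov function. -/
@[reducible] def optionMetricSpace {X : Type*} [MetricSpace X] (f : X → ℝ)
    (hf : IsKatetov id f) (hpos : ∀ x, 0 < f x) : MetricSpace (Option X) where
  dist x y := x.elim (y.elim 0 f) fun x => y.elim (f x) fun y => dist x y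
  dist_self x := by cases x <;> simp
  dist_comm x y := by cases x <;> cases y <;> simp [dist_comm]
  dist_triangle x y z := by
    rcases x with _ | x <;> rcases y with _ | y <;> rcases z with _ | z <;>
      simp only [Option.elim_none, Option.elim_some, add_zero, zero_add, le_refl,
        nonneg_add_self_iff]
    · exact (hpos y).le
    · have : f z - f y ≤ dist z y := hf.sub_le_dist z y
      rw [dist_comm z y] at this
      linarith
    · exact hf.dist_le_add x z
    · have : f x - f y ≤ dist x y := hf.sub_le_dist x y
      linarith
    · exact dist_triangle _ _ _
  eq_of_dist_eq_zero {x y} h := by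
    rcases x with _ | x <;> rcases y with _ | y <;>
      simp only [Option.elim_none, Option.elim_some, dist_eq_zero] at h
    · rfl
    · exact absurd h (hpos y).ne'
    · exact absurd h (hpos x).ne'
    · rw [h]

variable {X : Type u} [MetricSpace X]

theorem IsRationalUrysohn.exists_dist_eq (hX : IsRationalUrysohn X) (A : Set X) [Finite A]
    {f : A → ℝ} (hf : IsKatetov ((↑) : A → X) f) (hpos : ∀ x, 0 < f x)
    (hrat : ∀ x, ∃ r : ℚ, f x = r) : ∃ z : X, ∀ x : A, dist z x = f x := by
  let : MetricSpace (Option A) := optionMetricSpace f ⟨hf.1, hf.2⟩ hpos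
  have hA : HasRationalDistances A := fun x y => hX.rational x y
  have hOption : HasRationalDistances (Option A) := by
    rintro (_ | x) (_ | y)
    · exact ⟨0, by simp⟩
    · exact hrat y
    · exact hrat x
    · exact hX.rational x y
  obtain ⟨σ, hσ, hσA⟩ := hX.extension A (Option A) hA hOption Subtype.val some
    isometry_subtype_coe (Isometry.of_dist_eq fun _ _ => rfl)
  have hσx : ∀ x : A, σ (some x) = x := congrFun hσA
  exact ⟨σ none, fun x => hσx x ▸ hσ.dist_eq none (some x)⟩

theorem IsRationalUrysohn.hasApproxExtensionProperty (hX : IsRationalUrysohn X) :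
    HasApproxExtensionProperty X := by
  intro n a f hf ε hε
  choose r hfr hrf using fun i => exists_rat_btwn (show f i < f i + ε by linarith)
  let g : Fin n → ℝ := fun i => r i
  have hg : IsKatetov ((↑) : Set.range a → X) fun x => katetovHull a g x :=
    .of_nonempty fun ⟨x⟩ =>
      have : Nonempty (Fin n) := ⟨x.2.choose⟩
      (isKatetov_katetovHull fun i j => (hf.dist_le_add i j).trans
        (add_le_add (hfr i).le (hfr j).le)).comp _
  have hg_eq : ∀ x : Set.range a, ∃ i j, katetovHull a g x = r j + dist (a i) (a j) := by
    rintro ⟨_, i, rfl⟩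
    have : Nonempty (Fin n) := ⟨i⟩
    exact ⟨i, exists_katetovHull_eq a g (a i)⟩
  have hg_pos : ∀ x : Set.range a, 0 < katetovHull a g x := fun x => by
    obtain ⟨i, j, hij⟩ := hg_eq x
    exact hij ▸ add_pos_of_pos_of_nonneg ((hf.nonneg j).trans_lt (hfr j)) dist_nonneg
  have hg_rat : ∀ x : Set.range a, ∃ q : ℚ, katetovHull a g x = q := fun x => by
    obtain ⟨i, j, hij⟩ := hg_eq x
    obtain ⟨s, hs⟩ := hX.rational (a i) (a j)
    exact ⟨r j + s, by rw [hij, hs, Rat.cast_add]⟩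
  obtain ⟨z, hz⟩ := hX.exists_dist_eq (Set.range a) hg hg_pos hg_rat
  refine ⟨z, fun i => ?_⟩
  have hg_le : katetovHull a g (a i) ≤ r i := katetovHull_apply_le a g i
  have hg_ge : r i - ε ≤ katetovHull a g (a i) := sub_le_katetovHull a g i fun j => by
    linarith [show g j = r j from rfl, hf.sub_le_dist i j, hrf i, hfr j]
  rw [hz ⟨a i, i, rfl⟩, abs_le]
  constructor <;> linarith [hfr i, hrf i]

theorem IsUrysohnSpace.hasExtensionProperty (hX : IsUrysohnSpace X) : HasExtensionProperty X :=
  have := hX.complete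
  let ⟨_, hQdense, hQ⟩ := hX.dense_rational
  (hQ.hasApproxExtensionProperty.of_denseRange isometry_subtype_coe
    hQdense.denseRange_val).hasExtensionProperty

theorem IsUrysohnSpace.separableSpace (hX : IsUrysohnSpace X) :
    TopologicalSpace.SeparableSpace X :=
  let ⟨Q, hQdense, hQ⟩ := hX.dense_rational
  ⟨Q, hQ.countable, hQdense⟩

end UrysohnSpace

section PartialIsometry

/-- `R` is the graph of an isometry between a subset of `V` and a subset of `U`. -/
def IsPartialIsometry {V U : Type*} [PseudoMetricSpace V] [PseudoMetricSpace U]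
    (R : Set (V × U)) : Prop :=
  ∀ p ∈ R, ∀ q ∈ R, dist p.1 q.1 = dist p.2 q.2

namespace IsPartialIsometry

section PseudoMetricSpace

variable {V U : Type*} [PseudoMetricSpace V] [PseudoMetricSpace U] {R : Set (V × U)}

theorem image_swap (hR : IsPartialIsometry R) : IsPartialIsometry (Prod.swap '' R) := by
  rintro _ ⟨p, hp, rfl⟩ _ ⟨q, hq, rfl⟩
  exact (hR p hp q hq).symm

theorem exists_insert_right (hU : HasExtensionProperty U) (hfin : R.Finite)
    (hR : IsPartialIsometry R) (v : V) : ∃ u, IsPartialIsometry (insert (v, u) R) := by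
  have := hfin.to_subtype
  have hv : IsKatetov (fun p : R => p.1.2) fun p => dist v p.1.1 :=
    ⟨fun p q => hR p p.2 q q.2 ▸ (isKatetov_dist v).sub_le_dist p.1.1 q.1.1,
      fun p q => hR p p.2 q q.2 ▸ (isKatetov_dist v).dist_le_add p.1.1 q.1.1⟩
  obtain ⟨u, hu⟩ := hU.exists_of_finite hv
  refine ⟨u, ?_⟩
  rintro p (rfl | hp) q (rfl | hq)
  · simp
  · exact (hu ⟨q, hq⟩).symm
  · rw [dist_comm, dist_comm p.2]
    exact (hu ⟨p, hp⟩).symm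
  · exact hR p hp q hq

theorem exists_insert_left (hV : HasExtensionProperty V) (hfin : R.Finite)
    (hR : IsPartialIsometry R) (u : U) : ∃ v, IsPartialIsometry (insert (v, u) R) := by
  obtain ⟨v, hv⟩ := hR.image_swap.exists_insert_right hV (hfin.image _) u
  refine ⟨v, ?_⟩
  simpa only [Set.image_insert_eq, Set.image_image, Prod.swap_swap, Set.image_id',
    Prod.swap_prod_mk] using hv.image_swap

theorem exists_superset_of_finite (hU : HasExtensionProperty U) (hfin : R.Finite)
    (hR : IsPartialIsometry R) {T : Set V} (hT : T.Finite) :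
    ∃ S ⊇ R, IsPartialIsometry S ∧ ∀ v ∈ T, ∃ u, (v, u) ∈ S := by
  suffices ∃ S ⊇ R, S.Finite ∧ IsPartialIsometry S ∧ ∀ v ∈ T, ∃ u, (v, u) ∈ S from
    let ⟨S, hRS, _, hS⟩ := this
    ⟨S, hRS, hS⟩
  induction T, hT using Set.Finite.induction_on with
  | empty => exact ⟨R, subset_rfl, hfin, hR, by simp⟩
  | @insert v T _ _ ih =>
    obtain ⟨S, hRS, hSfin, hS, hTS⟩ := ih
    obtain ⟨u, hu⟩ := hS.exists_insert_right hU hSfin v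
    refine ⟨_, hRS.trans (Set.subset_insert _ _), hSfin.insert _, hu, ?_⟩
    rintro x (rfl | hx)
    · exact ⟨u, Set.mem_insert _ _⟩
    · exact (hTS x hx).imp fun _ => Set.mem_insert_of_mem _

theorem exists_superset_of_sequences (hV : HasExtensionProperty V) (hU : HasExtensionProperty U)
    (hfin : R.Finite) (hR : IsPartialIsometry R) (v : ℕ → V) (u : ℕ → U) :
    ∃ S ⊇ R, IsPartialIsometry S ∧ (∀ n, ∃ y, (v n, y) ∈ S) ∧ ∀ n, ∃ x, (x, u n) ∈ S := by
  let P := {S : Set (V × U) // S.Finite ∧ IsPartialIsometry S}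
  let D : ℕ ⊕ ℕ → Order.Cofinal P := Sum.elim
    (fun n => ⟨{S | ∃ y, (v n, y) ∈ S.1}, fun S =>
      let ⟨y, hy⟩ := S.2.2.exists_insert_right hU S.2.1 (v n)
      ⟨⟨_, S.2.1.insert _, hy⟩, ⟨y, Set.mem_insert _ _⟩, Set.subset_insert _ _⟩⟩)
    (fun n => ⟨{S | ∃ x, (x, u n) ∈ S.1}, fun S =>
      let ⟨x, hx⟩ := S.2.2.exists_insert_left hV S.2.1 (u n)
      ⟨⟨_, S.2.1.insert _, hx⟩, ⟨x, Set.mem_insert _ _⟩, Set.subset_insert _ _⟩⟩)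
  let R₀ : P := ⟨R, hfin, hR⟩
  let I := Order.idealOfCofinals R₀ D
  refine ⟨{p | ∃ S ∈ I, p ∈ S.1}, fun p hp => ⟨R₀, Order.mem_idealOfCofinals R₀ D, hp⟩,
    ?_, fun n => ?_, fun n => ?_⟩
  · rintro p ⟨S, hS, hp⟩ q ⟨S', hS', hq⟩
    obtain ⟨S'', -, hSS'', hS'S''⟩ := I.directed S hS S' hS'
    exact S''.2.2 p (hSS'' hp) q (hS'S'' hq)
  · obtain ⟨S, ⟨y, hy⟩, hS⟩ := Order.cofinal_meets_idealOfCofinals R₀ D (Sum.inl n)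
    exact ⟨y, S, hS, hy⟩
  · obtain ⟨S, ⟨x, hx⟩, hS⟩ := Order.cofinal_meets_idealOfCofinals R₀ D (Sum.inr n)
    exact ⟨x, S, hS, hx⟩

end PseudoMetricSpace

variable {V U : Type*} [MetricSpace V] [CompleteSpace V] [MetricSpace U] [CompleteSpace U]
  {R : Set (V × U)}

theorem exists_isometryEquiv_of_dense (hR : IsPartialIsometry R)
    (hfst : Dense (Prod.fst '' R)) (hsnd : Dense (Prod.snd '' R)) :
    ∃ η : V ≃ᵢ U, ∀ p ∈ R, η p.1 = p.2 := by
  rw [Set.image_eq_range] at hfst hsnd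
  have hi : Isometry (fun p : R => p.1.1) := Isometry.of_dist_eq fun p q => by
    rw [Subtype.dist_eq, Prod.dist_eq, ← hR p p.2 q q.2, max_self]
  have hj : Isometry (fun p : R => p.1.2) := Isometry.of_dist_eq fun p q => by
    rw [Subtype.dist_eq, Prod.dist_eq, hR p p.2 q q.2, max_self]
  let cV : AbstractCompletion R := ⟨V, fun p => p.1.1, inferInstance, inferInstance,
    inferInstance, hi.isUniformInducing, hfst⟩
  let cU : AbstractCompletion R := ⟨U, fun p => p.1.2, inferInstance, inferInstance,
    inferInstance, hj.isUniformInducing, hsnd⟩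
  let η : V ≃ᵤ U := cV.compareEquiv cU
  have hη : ∀ p : R, η p.1.1 = p.1.2 := cV.compare_coe cU
  refine ⟨⟨η.toEquiv, Isometry.of_dist_eq fun x y => ?_⟩, fun p hp => hη ⟨p, hp⟩⟩
  refine isClosed_property2 (p := fun x y => dist (η x) (η y) = dist x y) hfst
    (isClosed_eq ((η.continuous.comp continuous_fst).dist (η.continuous.comp continuous_snd))
      continuous_dist) (fun p q => ?_) x y
  rw [hη, hη, hR p p.2 q q.2]

variable [TopologicalSpace.SeparableSpace V] [TopologicalSpace.SeparableSpace U]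

theorem exists_isometryEquiv (hV : HasExtensionProperty V) (hU : HasExtensionProperty U)
    (hfin : R.Finite) (hR : IsPartialIsometry R) : ∃ η : V ≃ᵢ U, ∀ p ∈ R, η p.1 = p.2 := by
  have := hV.nonempty
  have := hU.nonempty
  obtain ⟨S, hRS, hS, hSV, hSU⟩ := hR.exists_superset_of_sequences hV hU hfin
    (TopologicalSpace.denseSeq V) (TopologicalSpace.denseSeq U)
  have hfst : Dense (Prod.fst '' S) := (TopologicalSpace.denseRange_denseSeq V).mono <|
    Set.range_subset_iff.2 fun n => let ⟨_, hy⟩ := hSV n; ⟨_, hy, rfl⟩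
  have hsnd : Dense (Prod.snd '' S) := (TopologicalSpace.denseRange_denseSeq U).mono <|
    Set.range_subset_iff.2 fun n => let ⟨_, hx⟩ := hSU n; ⟨_, hx, rfl⟩
  obtain ⟨η, hη⟩ := hS.exists_isometryEquiv_of_dense hfst hsnd
  exact ⟨η, fun p hp => hη p (hRS hp)⟩

end IsPartialIsometry

theorem exists_isometryEquiv_dist_le {V U : Type*} [MetricSpace V] [CompleteSpace V]
    [TopologicalSpace.SeparableSpace V] [MetricSpace U] [CompleteSpace U]
    [TopologicalSpace.SeparableSpace U] (hV : HasExtensionProperty V)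
    (hU : HasExtensionProperty U) {J : Type*} [Finite J] {p : J → V} {u : J → U} {ε : ℝ}
    (hε : 0 < ε) (h : ∀ i j, |dist (p i) (p j) - dist (u i) (u j)| ≤ 2 * ε) :
    ∃ η : V ≃ᵢ U, ∀ j, dist (η (p j)) (u j) ≤ ε := by
  rcases isEmpty_or_nonempty J with hJ | hJ
  · obtain ⟨η, -⟩ := IsPartialIsometry.exists_isometryEquiv hV hU (R := ∅) Set.finite_empty
      (by simp [IsPartialIsometry])
    exact ⟨η, isEmptyElim⟩
  -- Glue `V` to `U` with `p j` at distance `ε` from `u j`, and realize the `p j` over the `u j`.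
  let : MetricSpace (V ⊕ U) := Metric.glueMetricApprox p u ε hε h
  have hidentity : IsPartialIsometry (Set.range fun j => ((Sum.inr (u j) : V ⊕ U), u j)) := by
    rintro _ ⟨i, rfl⟩ _ ⟨j, rfl⟩
    rfl
  obtain ⟨S, hidS, hS, hpS⟩ := hidentity.exists_superset_of_finite hU (Set.finite_range _)
    (Set.finite_range fun j => (Sum.inl (p j) : V ⊕ U))
  choose q hq using fun j => hpS _ ⟨j, rfl⟩
  have hpq : IsPartialIsometry (Set.range fun j => (p j, q j)) := by
    rintro _ ⟨i, rfl⟩ _ ⟨j, rfl⟩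
    exact hS _ (hq i) _ (hq j)
  obtain ⟨η, hη⟩ := hpq.exists_isometryEquiv hV hU (Set.finite_range _)
  refine ⟨η, fun j => ?_⟩
  have hηp : η (p j) = q j := hη _ ⟨j, rfl⟩
  rw [hηp, ← hS _ (hq j) _ (hidS ⟨j, rfl⟩)]
  exact (Metric.glueDist_glued_points p u ε j).le

end PartialIsometry

section IsometryGroup

open Filter Topology

variable {β X : Type*} {l : Filter β}

theorem tendsto_isometryEquiv_iff [PseudoMetricSpace X] {φ : β → X ≃ᵢ X} {ψ : X ≃ᵢ X} :
    Tendsto φ l (𝓝 ψ) ↔ ∀ x, Tendsto (fun b => φ b x) l (𝓝 (ψ x)) :=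
  (IsInducing.induced fun φ : X ≃ᵢ X => (φ : X → X)).tendsto_nhds_iff.trans tendsto_pi_nhds

theorem tendsto_isometryEquiv_iff_of_denseRange [PseudoMetricSpace X] {κ : Type*} {u : κ → X}
    (hu : DenseRange u) {φ : β → X ≃ᵢ X} {ψ : X ≃ᵢ X} :
    Tendsto φ l (𝓝 ψ) ↔ ∀ i, Tendsto (fun b => φ b (u i)) l (𝓝 (ψ (u i))) := by
  refine tendsto_isometryEquiv_iff.trans ⟨fun h i => h (u i), fun h => ?_⟩
  have hequi : UniformEquicontinuous fun b x => φ b x :=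
    LipschitzWith.uniformEquicontinuous _ 1 fun b => (φ b).isometry.lipschitz
  exact isClosed_property hu (hequi.equicontinuous.isClosed_setOfPred_tendsto ψ.continuous) h

theorem continuous_monoidHom_apply {G M : Type*} [Group G] [Group M] [TopologicalSpace M]
    (g : G) : Continuous fun α : G →* M => α g :=
  (continuous_apply g).comp continuous_induced_dom

theorem tendsto_monoidHom_iff {G M : Type*} [Group G] [Group M] [TopologicalSpace M]
    {α : β → G →* M} {α₀ : G →* M} :
    Tendsto α l (𝓝 α₀) ↔ ∀ g, Tendsto (fun b => α b g) l (𝓝 (α₀ g)) :=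
  (IsInducing.induced fun α : G →* M => (α : G → M)).tendsto_nhds_iff.trans tendsto_pi_nhds

variable [MetricSpace X] {κ : Type*} {u : κ → X}

theorem isEmbedding_isometryEquiv_prodMk_symm (hu : DenseRange u) :
    IsEmbedding fun φ : X ≃ᵢ X => (φ ∘ u, φ.symm ∘ u) := by
  refine ⟨isInducing_iff_nhds.2 fun φ => le_antisymm ?_ ?_, fun φ ψ h => ?_⟩
  · refine Tendsto.le_comap (Continuous.tendsto ?_ φ)
    exact (continuous_pi fun i => continuous_iso_apply (u i)).prodMk
      (continuous_pi fun i => (continuous_iso_apply (u i)).comp continuous_inv)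
  · refine tendsto_id'.1 ((tendsto_isometryEquiv_iff_of_denseRange hu).2 fun i => ?_)
    have hφ : Tendsto (fun ψ : X ≃ᵢ X => (ψ ∘ u, ψ.symm ∘ u))
        (comap (fun ψ : X ≃ᵢ X => (ψ ∘ u, ψ.symm ∘ u)) (𝓝 (φ ∘ u, φ.symm ∘ u)))
        (𝓝 (φ ∘ u, φ.symm ∘ u)) := tendsto_comap
    exact tendsto_pi_nhds.1 ((continuous_fst.tendsto _).comp hφ) i
  · exact DFunLike.coe_injective
      (hu.equalizer φ.continuous ψ.continuous (congrArg Prod.fst h))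

variable [CompleteSpace X]

theorem range_isometryEquiv_prodMk_symm (hu : DenseRange u) :
    (Set.range fun φ : X ≃ᵢ X => (φ ∘ u, φ.symm ∘ u)) =
      {p | ∀ i j, dist (p.1 i) (p.1 j) = dist (u i) (u j) ∧
        dist (p.2 i) (p.2 j) = dist (u i) (u j) ∧ dist (p.1 i) (u j) = dist (u i) (p.2 j)} := by
  refine Set.Subset.antisymm ?_ fun ⟨a, b⟩ h => ?_
  · rintro _ ⟨φ, rfl⟩ i j
    exact ⟨φ.dist_eq _ _, φ.symm.dist_eq _ _,
      (φ.dist_eq (u i) _ ▸ congrArg (dist (φ (u i))) (φ.apply_symm_apply (u j)).symm :)⟩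
  · have hR : IsPartialIsometry
        (Set.range (Sum.elim (fun i => (u i, a i)) fun i => (b i, u i))) := by
      rintro _ ⟨i | i, rfl⟩ _ ⟨j | j, rfl⟩
      · exact (h i j).1.symm
      · exact (h i j).2.2.symm
      · simpa only [Sum.elim_inl, Sum.elim_inr, dist_comm] using (h j i).2.2.symm
      · exact (h i j).2.1
    obtain ⟨φ, hφ⟩ := hR.exists_isometryEquiv_of_dense
      (hu.mono <| Set.range_subset_iff.2 fun i => ⟨_, ⟨Sum.inl i, rfl⟩, rfl⟩)
      (hu.mono <| Set.range_subset_iff.2 fun i => ⟨_, ⟨Sum.inr i, rfl⟩, rfl⟩)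
    refine ⟨φ, Prod.ext (funext fun i => hφ _ ⟨Sum.inl i, rfl⟩) (funext fun i => ?_)⟩
    exact φ.symm_apply_eq.2 (hφ _ ⟨Sum.inr i, rfl⟩).symm

theorem polishSpace_isometryEquiv (X : Type*) [MetricSpace X] [CompleteSpace X]
    [TopologicalSpace.SeparableSpace X] : PolishSpace (X ≃ᵢ X) := by
  obtain ⟨s, hs, hsd⟩ := TopologicalSpace.exists_countable_dense X
  have := hs.to_subtype
  have := UniformSpace.secondCountable_of_separable X
  refine IsClosedEmbedding.polishSpace
    ⟨isEmbedding_isometryEquiv_prodMk_symm hsd.denseRange_val, ?_⟩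
  rw [range_isometryEquiv_prodMk_symm hsd.denseRange_val]
  simp only [Set.ofPred_forall, Set.ofPred_and]
  refine isClosed_iInter fun i => isClosed_iInter fun j => ?_
  refine (isClosed_eq ?_ ?_).inter ((isClosed_eq ?_ ?_).inter (isClosed_eq ?_ ?_)) <;> fun_prop

end IsometryGroup

section KatetovOrbitDist

variable {G X ι : Type*} [Group G] [PseudoMetricSpace X] [MulAction G X] [IsIsometricSMul G X]

/-- `ρ g i j` is the distance between `(1, i)` and `(g, j)` for some pseudometric on `G × ι`
invariant under left multiplication on the first coordinate. -/
structure IsOrbitPseudometric {G ι : Type*} [Group G] (ρ : G → ι → ι → ℝ) : Prop where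
  self : ∀ i, ρ 1 i i = 0
  inv : ∀ g i j, ρ g⁻¹ j i = ρ g i j
  mul_le : ∀ g h i j k, ρ (g * h) i k ≤ ρ g i j + ρ h j k

theorem IsOrbitPseudometric.nonneg {ρ : G → ι → ι → ℝ} (hρ : IsOrbitPseudometric ρ) (g : G)
    (i j : ι) : 0 ≤ ρ g i j := by
  have := hρ.mul_le g g⁻¹ i j i
  rw [mul_inv_cancel, hρ.self, hρ.inv] at this
  linarith

theorem IsKatetov.comp_smul {F : X → ℝ} (hF : IsKatetov id F) (g : G) :
    IsKatetov id fun x => F (g • x) where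
  sub_le_dist x y := (hF.sub_le_dist (g • x) (g • y)).trans_eq (dist_smul g x y)
  dist_le_add x y := (dist_smul g x y).symm.trans_le (hF.dist_le_add (g • x) (g • y))

/-- The orbit pseudometric given by the uniform distance between the translates of the
functions `Φ i`. -/
noncomputable def katetovOrbitDist (Φ : ι → X → ℝ) (g : G) (i j : ι) : ℝ :=
  ⨆ x, |Φ i x - Φ j (g⁻¹ • x)|

variable {Φ : ι → X → ℝ}

theorem bddAbove_range_abs_sub_smul (hΦ : ∀ i, IsKatetov id (Φ i)) (g : G) (i j : ι) :
    BddAbove (Set.range fun x => |Φ i x - Φ j (g • x)|) := by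
  rcases isEmpty_or_nonempty X with hX | ⟨⟨y⟩⟩
  · exact Set.range_eq_empty (ι := X) _ ▸ bddAbove_empty
  · exact ⟨_, Set.forall_mem_range.2 fun x => (hΦ i).abs_sub_le_add ((hΦ j).comp_smul g) x y⟩

theorem isOrbitPseudometric_katetovOrbitDist (hΦ : ∀ i, IsKatetov id (Φ i)) :
    IsOrbitPseudometric (katetovOrbitDist Φ : G → ι → ι → ℝ) where
  self i := by simp [katetovOrbitDist]
  inv g i j := Equiv.iSup_congr (MulAction.toPerm g) fun x => by
    rw [MulAction.toPerm_apply, inv_smul_smul, inv_inv, abs_sub_comm]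
  mul_le g h i j k := by
    have hg := bddAbove_range_abs_sub_smul hΦ g⁻¹ i j
    have hh := bddAbove_range_abs_sub_smul hΦ h⁻¹ j k
    refine Real.iSup_le (fun x => ?_) (add_nonneg (Real.iSup_nonneg fun _ => abs_nonneg _)
      (Real.iSup_nonneg fun _ => abs_nonneg _))
    rw [mul_inv_rev, mul_smul]
    exact (abs_sub_le _ (Φ j (g⁻¹ • x)) _).trans
      (add_le_add (le_ciSup hg x) (le_ciSup hh (g⁻¹ • x)))

theorem katetovOrbitDist_eq_apply (hΦ : ∀ i, IsKatetov id (Φ i)) {i : ι} {x : X}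
    (hi : Φ i = dist x) (g : G) (j : ι) : katetovOrbitDist Φ g i j = Φ j (g⁻¹ • x) := by
  have : Nonempty X := ⟨x⟩
  have hx : Φ i x = 0 := by rw [hi, dist_self]
  refine le_antisymm (ciSup_le fun y => ?_) ?_
  · simpa only [hx, zero_add] using (hΦ i).abs_sub_le_add ((hΦ j).comp_smul g⁻¹) y x
  · refine le_trans ?_ (le_ciSup (bddAbove_range_abs_sub_smul hΦ g⁻¹ i j) x)
    rw [hx, zero_sub, abs_neg]
    exact le_abs_self _

end KatetovOrbitDist

section OrbitPseudometric

open Filter Topology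

variable {G ι κ : Type*} [Group G]

/-- The space of orbit pseudometrics, with the topology of pointwise convergence. -/
abbrev OrbitPseudometric (G ι : Type*) [Group G] : Type _ :=
  {ρ : G → ι → ι → ℝ // IsOrbitPseudometric ρ}

instance [Countable G] [Countable ι] : PolishSpace (OrbitPseudometric G ι) := by
  refine IsClosed.polishSpace (s := {ρ : G → ι → ι → ℝ | IsOrbitPseudometric ρ}) ?_
  have : {ρ : G → ι → ι → ℝ | IsOrbitPseudometric ρ} = {ρ | ∀ i, ρ 1 i i = 0} ∩
      ({ρ | ∀ g i j, ρ g⁻¹ j i = ρ g i j} ∩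
        {ρ | ∀ g h i j k, ρ (g * h) i k ≤ ρ g i j + ρ h j k}) :=
    Set.ext fun ρ => ⟨fun h => ⟨h.1, h.2, h.3⟩, fun h => ⟨h.1, h.2.1, h.2.2⟩⟩
  rw [this]
  simp only [Set.ofPred_forall]
  refine .inter ?_ (.inter ?_ ?_)
  · exact isClosed_iInter fun i => isClosed_eq (by fun_prop) continuous_const
  · exact isClosed_iInter fun g => isClosed_iInter fun i => isClosed_iInter fun j =>
      isClosed_eq (by fun_prop) (by fun_prop)
  · exact isClosed_iInter fun g => isClosed_iInter fun h => isClosed_iInter fun i =>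
      isClosed_iInter fun j => isClosed_iInter fun k => isClosed_le (by fun_prop) (by fun_prop)

namespace OrbitPseudometric

/-- The pseudometric on `G × ι` encoded by `d`. -/
def toDist (d : OrbitPseudometric G ι) (p q : G × ι) : ℝ :=
  d.1 (p.1⁻¹ * q.1) p.2 q.2

theorem continuous_toDist (p q : G × ι) :
    Continuous fun d : OrbitPseudometric G ι => d.toDist p q :=
  Continuous.comp (g := fun ρ : G → ι → ι → ℝ => ρ (p.1⁻¹ * q.1) p.2 q.2) (by fun_prop)
    continuous_subtype_val

/-- The pseudometric space `G × ι` with the distance `d.toDist`, on which `G` acts by left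
multiplication on the first coordinate. -/
def OrbitSpace (_ : OrbitPseudometric G ι) : Type _ :=
  G × ι

variable (d : OrbitPseudometric G ι)

instance : PseudoMetricSpace d.OrbitSpace where
  dist := d.toDist
  dist_self p := by
    change d.1 (p.1⁻¹ * p.1) p.2 p.2 = 0
    rw [inv_mul_cancel, d.2.self]
  dist_comm p q := by
    change d.1 (p.1⁻¹ * q.1) p.2 q.2 = d.1 (q.1⁻¹ * p.1) q.2 p.2
    rw [← d.2.inv, mul_inv_rev, inv_inv]
  dist_triangle p q r := by
    change d.1 (p.1⁻¹ * r.1) p.2 r.2 ≤ d.1 (p.1⁻¹ * q.1) p.2 q.2 + d.1 (q.1⁻¹ * r.1) q.2 r.2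
    rw [← mul_inv_cancel_left q.1 r.1, ← mul_assoc, inv_mul_cancel_left]
    exact d.2.mul_le _ _ _ _ _

instance : MulAction G d.OrbitSpace where
  smul g p := (g * p.1, p.2)
  one_smul p := Prod.ext (one_mul p.1) rfl
  mul_smul g h p := Prod.ext (mul_assoc g h p.1) rfl

instance : IsIsometricSMul G d.OrbitSpace where
  isometry_smul g := Isometry.of_dist_eq fun p q => by
    change d.1 ((g * p.1)⁻¹ * (g * q.1)) p.2 q.2 = d.1 (p.1⁻¹ * q.1) p.2 q.2
    rw [mul_inv_rev, mul_assoc, inv_mul_cancel_left]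

theorem exists_replace_orbit (n : ι) {F : d.OrbitSpace → ℝ} (hF : IsKatetov id F) :
    ∃ d' : OrbitPseudometric G ι, (∀ g i j, i ≠ n → j ≠ n → d'.1 g i j = d.1 g i j) ∧
      ∀ q : G × ι, q.2 ≠ n → d'.toDist (1, n) q = F q := by
  classical
  let x : ι → d.OrbitSpace := fun i => (1, i)
  let Φ : ι → d.OrbitSpace → ℝ := Function.update (fun i => dist (x i)) n F
  have hΦ : ∀ i, IsKatetov id (Φ i) := fun i => by
    rcases eq_or_ne i n with rfl | hi
    · simpa only [Φ, Function.update_self] using hF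
    · simpa only [Φ, Function.update_of_ne hi] using isKatetov_dist (x i)
  let d' : OrbitPseudometric G ι := ⟨katetovOrbitDist Φ, isOrbitPseudometric_katetovOrbitDist hΦ⟩
  have hd' : ∀ g i j, i ≠ n → d'.1 g i j = Φ j (g⁻¹ • x i) := fun g i j hi =>
    katetovOrbitDist_eq_apply hΦ (Function.update_of_ne hi ..) g j
  refine ⟨d', fun g i j hi hj => ?_, fun q hq => ?_⟩
  · rw [hd' g i j hi, show Φ j = dist (x j) from Function.update_of_ne hj ..]
    change d.1 (1⁻¹ * (g⁻¹ * 1)) j i = d.1 g i j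
    rw [inv_one, one_mul, mul_one, d.2.inv]
  · change d'.1 (1⁻¹ * q.1) n q.2 = F q
    rw [← d'.2.inv, hd' _ _ _ hq, show Φ n = F from Function.update_self ..]
    change F ((1⁻¹ * q.1)⁻¹⁻¹ * 1, q.2) = F q
    rw [inv_inv, inv_one, one_mul, mul_one]

/-- The orbit pseudometrics in which either some point realizes `r` on the family `a` up to `2 * ε`,
or `r` is too far from being a Katětov function on `a`. -/
def approxRealizing (a : κ → G × ι) (r : κ → ℚ) (ε : ℝ) : Set (OrbitPseudometric G ι) :=
  {d | (∃ i j, d.toDist (a i) (a j) + ε < r i - r j ∨ r i + r j < d.toDist (a i) (a j)) ∨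
    ∃ z, ∀ i, |d.toDist z (a i) - r i| < 2 * ε}

variable [Finite κ]

theorem isOpen_approxRealizing (a : κ → G × ι) (r : κ → ℚ) (ε : ℝ) :
    IsOpen (approxRealizing a r ε) := by
  simp only [approxRealizing, Set.ofPred_or, Set.ofPred_exists, Set.ofPred_forall]
  refine .union (isOpen_iUnion fun i => isOpen_iUnion fun j => .union ?_ ?_)
    (isOpen_iUnion fun z => isOpen_iInter_of_finite fun i => ?_)
  · exact isOpen_lt ((continuous_toDist _ _).add continuous_const) continuous_const
  · exact isOpen_lt continuous_const (continuous_toDist _ _)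
  · exact isOpen_lt ((continuous_toDist _ _).sub continuous_const).abs continuous_const

theorem dense_approxRealizing [Infinite ι] (a : κ → G × ι) (r : κ → ℚ) {ε : ℝ} (hε : 0 < ε) :
    Dense (approxRealizing a r ε) := fun d => by
  rcases isEmpty_or_nonempty κ with hκ | hκ
  · exact subset_closure (Or.inr ⟨(1, Classical.arbitrary ι), isEmptyElim⟩)
  by_cases hr : ∃ i j, d.toDist (a i) (a j) + ε < r i - r j ∨ r i + r j < d.toDist (a i) (a j)
  · exact subset_closure (Or.inl hr)
  push Not at hr
  let b : κ → d.OrbitSpace := a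
  let F : d.OrbitSpace → ℝ := katetovHull b fun i => (r i : ℝ)
  have hF : IsKatetov id F := isKatetov_katetovHull fun i j => (hr i j).2
  have hF_le : ∀ i, F (a i) ≤ r i := katetovHull_apply_le b _
  have hF_ge : ∀ i, r i - ε ≤ F (a i) := fun i =>
    sub_le_katetovHull b (fun i => (r i : ℝ)) i fun j => (hr i j).1
  choose D hD hDF using fun n => d.exists_replace_orbit n hF
  -- `D n` only changes the distances to the `n`-th orbit, so that it tends to `d`.
  refine mem_closure_of_tendsto (b := cofinite) (f := D) ?_ ?_
  · simp only [tendsto_subtype_rng, tendsto_pi_nhds]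
    refine fun g i j => tendsto_const_nhds.congr' ?_
    filter_upwards [(Set.finite_singleton i).eventually_cofinite_notMem,
      (Set.finite_singleton j).eventually_cofinite_notMem] with n hi hj
    exact (hD n g i j (Ne.symm hi) (Ne.symm hj)).symm
  · filter_upwards [((Set.finite_range a).image Prod.snd).eventually_cofinite_notMem] with n hn
    refine Or.inr ⟨(1, n), fun i => ?_⟩
    rw [hDF n (a i) fun h => hn ⟨a i, ⟨i, rfl⟩, h⟩, abs_lt]
    constructor <;> linarith [hF_le i, hF_ge i]

theorem hasApproxExtensionProperty_of_mem_approxRealizing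
    (hd : ∀ (n : ℕ) (a : Fin n → G × ι) (r : Fin n → ℚ) (k : ℕ),
      d ∈ approxRealizing a r (1 / (k + 1))) : HasApproxExtensionProperty d.OrbitSpace := by
  intro n a f hf ε hε
  obtain ⟨k, hk⟩ := exists_nat_one_div_lt (show 0 < ε / 3 by positivity)
  have hη : 0 < 1 / ((k : ℝ) + 1) := by positivity
  have := hd n a
  set η : ℝ := 1 / ((k : ℝ) + 1)
  choose r hfr hrf using fun i => exists_rat_btwn (show f i < f i + η by linarith)
  rcases this r k with ⟨i, j, h | h⟩ | ⟨z, hz⟩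
  · have : f i - f j ≤ d.toDist (a i) (a j) := hf.sub_le_dist i j
    linarith [hfr j, hrf i]
  · have : d.toDist (a i) (a j) ≤ f i + f j := hf.dist_le_add i j
    linarith [hfr i, hfr j]
  · refine ⟨z, fun i => ?_⟩
    have := abs_lt.1 (hz i)
    change |d.toDist z (a i) - f i| ≤ ε
    rw [abs_le]
    constructor <;> linarith [hfr i, hrf i]

theorem dense_setOf_hasApproxExtensionProperty [Countable G] [Countable ι] [Infinite ι] :
    Dense {d : OrbitPseudometric G ι | HasApproxExtensionProperty d.OrbitSpace} := by
  have : Dense (⋂ x : Σ n : ℕ, (Fin n → G × ι) × (Fin n → ℚ) × ℕ,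
      approxRealizing x.2.1 x.2.2.1 (1 / (x.2.2.2 + 1))) :=
    dense_iInter_of_isOpen (fun _ => isOpen_approxRealizing _ _ _)
      fun _ => dense_approxRealizing _ _ (by positivity)
  exact this.mono fun d hd => hasApproxExtensionProperty_of_mem_approxRealizing d
    fun n a r k => Set.mem_iInter.1 hd ⟨n, a, r, k⟩

end OrbitPseudometric

end OrbitPseudometric

section Realization

instance {G X : Type*} [PseudoMetricSpace X] [SMul G X] [IsIsometricSMul G X] :
    UniformContinuousConstSMul G X where
  uniformContinuous_const_smul g := (isometry_smul X g).uniformContinuous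

instance {G X : Type*} [PseudoMetricSpace X] [SMul G X] [IsIsometricSMul G X] :
    IsIsometricSMul G (UniformSpace.Completion X) where
  isometry_smul g := (isometry_smul X g).completion_map

/-- The homomorphism to the isometry group of `U` given by an isometric action on `X` and an
identification of `X` with `U`. -/
def conjIsometryHom {G X U : Type*} [Group G] [PseudoMetricSpace X] [MulAction G X]
    [IsIsometricSMul G X] [PseudoMetricSpace U] (η : X ≃ᵢ U) : G →* (U ≃ᵢ U) where
  toFun g := (η.symm.trans (IsometryEquiv.constSMul g)).trans η
  map_one' := by ext x; simp
  map_mul' g h := by ext x; simp [mul_smul]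

open OrbitPseudometric in
theorem OrbitPseudometric.exists_hom_isometryEquiv_dist_le {G ι U : Type*} [Group G] [Countable G]
    [Countable ι] [Infinite ι] [MetricSpace U] [CompleteSpace U]
    [TopologicalSpace.SeparableSpace U] (hU : HasExtensionProperty U)
    (d : OrbitPseudometric G ι) {J : Type*} [Finite J] {s : J → G × ι} {u : J → U} {ε : ℝ}
    (hε : 0 < ε) (h : ∀ a b, |d.toDist (s a) (s b) - dist (u a) (u b)| < 2 * ε) :
    ∃ (α : G →* (U ≃ᵢ U)) (y : ι → U), ∀ j, dist (α (s j).1 (y (s j).2)) (u j) ≤ ε := by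
  have hopen : IsOpen {d : OrbitPseudometric G ι |
      ∀ a b, |d.toDist (s a) (s b) - dist (u a) (u b)| < 2 * ε} := by
    simp only [Set.ofPred_forall]
    exact isOpen_iInter_of_finite fun a => isOpen_iInter_of_finite fun b =>
      isOpen_lt ((continuous_toDist _ _).sub continuous_const).abs continuous_const
  obtain ⟨d', hd', hext⟩ :=
    dense_setOf_hasApproxExtensionProperty.inter_open_nonempty _ hopen ⟨d, h⟩
  let x : d'.OrbitSpace → UniformSpace.Completion d'.OrbitSpace := (↑)
  have hx : Isometry x := UniformSpace.Completion.coe_isometry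
  have hV := (hext.of_denseRange hx UniformSpace.Completion.denseRange_coe).hasExtensionProperty
  have : Countable d'.OrbitSpace := inferInstanceAs (Countable (G × ι))
  obtain ⟨η, hη⟩ := exists_isometryEquiv_dist_le hV hU (p := fun j => x (s j)) hε fun a b =>
    (hx.dist_eq (s a) (s b) ▸ hd' a b : |dist (x (s a)) (x (s b)) - dist (u a) (u b)| < _).le
  refine ⟨conjIsometryHom η, fun i => η (x (1, i)), fun j => ?_⟩
  have horbit : (s j).1 • x (1, (s j).2) = x (s j) :=
    (UniformSpace.Completion.coe_smul _ _).symm.trans (congrArg x (Prod.ext (mul_one _) rfl))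
  simpa only [conjIsometryHom, MonoidHom.coe_mk, OneHom.coe_mk, IsometryEquiv.trans_apply,
    IsometryEquiv.symm_apply_apply, IsometryEquiv.constSMul_apply, horbit] using hη j

end Realization

section Pushforward

variable {Γ G ι : Type*} [Group Γ] [Group G]

/-- The largest orbit pseudometric on `G` which is bounded by `C` and by `ρ` along `Ψ`, for an orbit
pseudometric `ρ` on `Γ`. The index `none` contributes the bound `C`. -/
noncomputable def orbitPushforward (Ψ : Γ →* G) (C : ℝ) (ρ : Γ → ι → ι → ℝ) (g : G) (i j : ι) :
    ℝ :=
  ⨅ o : Option {w // Ψ w = g}, o.elim C fun w => ρ w i j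

variable {Ψ : Γ →* G} {C : ℝ} {ρ : Γ → ι → ι → ℝ} {g : G} {i j : ι}

theorem le_orbitPushforward {m : ℝ} (hC : m ≤ C) (h : ∀ w, Ψ w = g → m ≤ ρ w i j) :
    m ≤ orbitPushforward Ψ C ρ g i j := by
  refine le_ciInf ?_
  rintro (_ | ⟨w, hw⟩)
  exacts [hC, h w hw]

theorem bddBelow_range_orbitPushforward (hρ : IsOrbitPseudometric ρ) (hC : 0 ≤ C) (g : G)
    (i j : ι) :
    BddBelow (Set.range fun o : Option {w // Ψ w = g} => o.elim C fun w => ρ w i j) := by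
  refine ⟨0, ?_⟩
  rintro _ ⟨_ | w, rfl⟩
  exacts [hC, hρ.nonneg w i j]

theorem orbitPushforward_le_const (hρ : IsOrbitPseudometric ρ) (hC : 0 ≤ C) (g : G) (i j : ι) :
    orbitPushforward Ψ C ρ g i j ≤ C :=
  ciInf_le (bddBelow_range_orbitPushforward hρ hC g i j) none

theorem orbitPushforward_map_le (hρ : IsOrbitPseudometric ρ) (hC : 0 ≤ C) (w : Γ) (i j : ι) :
    orbitPushforward Ψ C ρ (Ψ w) i j ≤ ρ w i j :=
  ciInf_le (bddBelow_range_orbitPushforward hρ hC (Ψ w) i j) (some ⟨w, rfl⟩)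

theorem orbitPushforward_inv_le (hρ : IsOrbitPseudometric ρ) (hC : 0 ≤ C) (g : G) (i j : ι) :
    orbitPushforward Ψ C ρ g⁻¹ j i ≤ orbitPushforward Ψ C ρ g i j := by
  refine le_orbitPushforward (orbitPushforward_le_const hρ hC _ _ _) ?_
  rintro w rfl
  rw [← map_inv, ← hρ.inv w]
  exact orbitPushforward_map_le hρ hC _ _ _

theorem isOrbitPseudometric_orbitPushforward (Ψ : Γ →* G) (hρ : IsOrbitPseudometric ρ)
    (hC : 0 ≤ C) : IsOrbitPseudometric (orbitPushforward Ψ C ρ) := by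
  have hnonneg (g i j) : 0 ≤ orbitPushforward Ψ C ρ g i j :=
    le_orbitPushforward hC fun w _ => hρ.nonneg w i j
  refine ⟨fun i => (hnonneg 1 i i).antisymm' ?_, fun g i j => ?_, fun g h i j k => ?_⟩
  · simpa only [map_one, hρ.self] using orbitPushforward_map_le (Ψ := Ψ) hρ hC 1 i i
  · refine (orbitPushforward_inv_le hρ hC g i j).antisymm ?_
    simpa only [inv_inv] using orbitPushforward_inv_le hρ hC g⁻¹ j i
  · have hle_const := orbitPushforward_le_const (Ψ := Ψ) hρ hC (g * h) i k
    refine le_ciInf_add_ciInf ?_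
    rintro (_ | ⟨w, rfl⟩) o
    · refine hle_const.trans (le_add_of_nonneg_right ?_)
      rcases o with _ | w'
      exacts [hC, hρ.nonneg w' j k]
    rcases o with _ | ⟨w', rfl⟩
    · exact hle_const.trans (le_add_of_nonneg_left (hρ.nonneg w i j))
    · rw [← map_mul]
      exact (orbitPushforward_map_le hρ hC _ _ _).trans (hρ.mul_le w w' i j k)

end Pushforward

section Displacement

variable {Γ G ι U : Type*} [Group Γ] [Group G] [PseudoMetricSpace U] {Θ : Γ →* (U ≃ᵢ U)}
  {L : GroupSeminorm Γ} {x : ι → U}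

/-- The orbit pseudometric of the points `x i` under the isometric action `Θ`, with the additional
cost `L` for moving inside `Γ`. -/
def orbitDisplacement (Θ : Γ →* (U ≃ᵢ U)) (L : GroupSeminorm Γ) (x : ι → U) (w : Γ) (i j : ι) : ℝ :=
  dist (x i) (Θ w (x j)) + L w

theorem isOrbitPseudometric_orbitDisplacement (Θ : Γ →* (U ≃ᵢ U)) (L : GroupSeminorm Γ)
    (x : ι → U) : IsOrbitPseudometric (orbitDisplacement Θ L x) where
  self i := by simp [orbitDisplacement]
  inv w i j := by
    rw [orbitDisplacement, orbitDisplacement, map_inv_eq_map L, ← (Θ w).dist_eq, map_inv Θ,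
      IsometryEquiv.apply_inv_self, dist_comm]
  mul_le w w' i j k := by
    have hdist := dist_triangle (x i) (Θ w (x j)) (Θ w (Θ w' (x k)))
    rw [(Θ w).dist_eq] at hdist
    rw [orbitDisplacement, orbitDisplacement, orbitDisplacement, map_mul, IsometryEquiv.mul_apply]
    linarith [map_mul_le_add L w w']

theorem abs_orbitPushforward_orbitDisplacement_sub_dist_le (Ψ : Γ →* G) {C : ℝ} {k : Γ} {i j : ι}
    (hk : dist (x i) (Θ k (x j)) ≤ C)
    (hker : ∀ w, L w ≤ C + L k → Ψ w = 1 → Θ w (x j) = x j) :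
    |orbitPushforward Ψ C (orbitDisplacement Θ L x) (Ψ k) i j - dist (x i) (Θ k (x j))| ≤ L k := by
  have hupper := orbitPushforward_map_le (Ψ := Ψ) (isOrbitPseudometric_orbitDisplacement Θ L x)
    (dist_nonneg.trans hk) k i j
  have hlower : dist (x i) (Θ k (x j)) ≤
      orbitPushforward Ψ C (orbitDisplacement Θ L x) (Ψ k) i j := by
    refine le_orbitPushforward hk fun w hw => ?_
    rcases le_total C (L w) with hCL | hLC
    · exact (hk.trans hCL).trans (le_add_of_nonneg_left dist_nonneg)
    have hfix : Θ (k⁻¹ * w) (x j) = x j := by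
      refine hker _ ?_ (by rw [map_mul, map_inv, hw, inv_mul_cancel])
      linarith [map_mul_le_add L k⁻¹ w, map_inv_eq_map L k]
    rw [map_mul, map_inv, IsometryEquiv.mul_apply, ← (Θ k).injective.eq_iff,
      IsometryEquiv.apply_inv_self] at hfix
    rw [← hfix]
    exact le_add_of_nonneg_right (apply_nonneg L w)
  rw [orbitDisplacement] at hupper
  rw [abs_le]
  constructor <;> linarith [apply_nonneg L k]

end Displacement

section WordSeminorm

variable {α : Type*} [DecidableEq α]

/-- The word length on a free group, multiplied by `ε`. -/
def wordSeminorm (α : Type*) [DecidableEq α] {ε : ℝ} (hε : 0 ≤ ε) :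
    GroupSeminorm (FreeGroup α) where
  toFun w := ε * w.norm
  map_one' := by simp
  mul_le' w w' := by
    rw [← mul_add]
    exact mul_le_mul_of_nonneg_left (mod_cast FreeGroup.norm_mul_le w w') hε
  inv' w := by rw [FreeGroup.norm_inv_eq]

theorem wordSeminorm_of_inv_mul_of_le {ε : ℝ} (hε : 0 ≤ ε) (a b : α) :
    wordSeminorm α hε ((FreeGroup.of a)⁻¹ * FreeGroup.of b) ≤ 2 * ε := by
  have h : ∀ c : α, wordSeminorm α hε (FreeGroup.of c) = ε := fun c => by
    change ε * (FreeGroup.of c).norm = ε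
    rw [FreeGroup.norm_of, Nat.cast_one, mul_one]
  linarith [map_mul_le_add (wordSeminorm α hε) (FreeGroup.of a)⁻¹ (FreeGroup.of b),
    map_inv_eq_map (wordSeminorm α hε) (FreeGroup.of a), h a, h b]

theorem finite_setOf_wordSeminorm_le [Finite α] {ε : ℝ} (hε : 0 < ε) (C : ℝ) :
    {w | wordSeminorm α hε.le w ≤ C}.Finite := by
  obtain ⟨n, hn⟩ := exists_nat_ge (C / ε)
  refine .of_finite_image ((List.finite_length_le (α × Bool) n).subset ?_)
    FreeGroup.toWord_injective.injOn
  rintro _ ⟨w, hw, rfl⟩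
  have hw : ε * w.norm ≤ C := hw
  exact_mod_cast ((le_div_iff₀' hε).2 hw).trans hn

end WordSeminorm

theorem exists_orbitPseudometric_of_freeGroup {α ι U : Type*} [Finite α] [PseudoMetricSpace U]
    (Θ : FreeGroup α →* (U ≃ᵢ U)) (x : ι → U) {J : Set ι} (hJ : J.Finite) {δ : ℝ} (hδ : 0 < δ) :
    ∃ W : Finset (FreeGroup α), ∀ {G : Type*} [Group G] (Ψ : FreeGroup α →* G),
      (∀ w ∈ W, Ψ w = 1 → ∀ i ∈ J, Θ w (x i) = x i) →
      ∃ d : OrbitPseudometric G ι, ∀ a b, ∀ i ∈ J, ∀ j ∈ J,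
        |d.toDist (Ψ (.of a), i) (Ψ (.of b), j) -
          dist (Θ (.of a) (x i)) (Θ (.of b) (x j))| ≤ δ := by
  classical
  have := hJ.to_subtype
  let L := wordSeminorm α (half_pos hδ).le
  obtain ⟨C, hC⟩ := (Set.finite_range fun z : (α × J) × (α × J) =>
    dist (Θ (.of z.1.1) (x z.1.2)) (Θ (.of z.2.1) (x z.2.2))).bddAbove
  have hL (a b) : L ((FreeGroup.of a)⁻¹ * FreeGroup.of b) ≤ δ :=
    (wordSeminorm_of_inv_mul_of_le _ a b).trans_eq (mul_div_cancel₀ _ two_ne_zero)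
  have hfin := finite_setOf_wordSeminorm_le (α := α) (half_pos hδ) (max C 0 + δ)
  refine ⟨hfin.toFinset, fun {G} _ Ψ hΨ => ?_⟩
  refine ⟨⟨_, isOrbitPseudometric_orbitPushforward Ψ
    (isOrbitPseudometric_orbitDisplacement Θ L x) (le_max_right C 0)⟩, fun a b i hi j hj => ?_⟩
  have hΘ : dist (x i) (Θ ((.of a)⁻¹ * .of b) (x j)) =
      dist (Θ (.of a) (x i)) (Θ (.of b) (x j)) := by
    rw [← (Θ (.of a)).dist_eq, map_mul, map_inv, IsometryEquiv.mul_apply,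
      IsometryEquiv.apply_inv_self]
  have hdist := abs_orbitPushforward_orbitDisplacement_sub_dist_le (L := L) Ψ (C := max C 0)
    (hΘ.trans_le ((hC ⟨((a, ⟨i, hi⟩), (b, ⟨j, hj⟩)), rfl⟩).trans (le_max_left C 0)))
    fun w hw hw1 => hΨ w (hfin.mem_toFinset.2 (hw.trans (add_le_add_right (hL a b) _))) hw1 j hj
  rw [hΘ, map_mul, map_inv] at hdist
  exact hdist.trans (hL a b)

section FiniteApproximation

open Equiv

variable {Ω : Type*}

theorem exists_finset_freeGroup_hom_apply_eq {α : Type*} (Θ : FreeGroup α →* Perm Ω)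
    (w : FreeGroup α) (s : Ω) : ∃ T : Finset Ω, ∀ Θ' : FreeGroup α →* Perm Ω,
      (∀ a, ∀ x ∈ T, Θ' (.of a) x = Θ (.of a) x) → Θ' w s = Θ w s := by
  classical
  induction w using FreeGroup.induction_on generalizing s with
  | C1 => exact ⟨∅, fun Θ' _ => by rw [map_one, map_one]⟩
  | of a => exact ⟨{s}, fun Θ' h => h a s (Finset.mem_singleton_self s)⟩
  | inv_of a _ =>
    refine ⟨{(Θ (.of a))⁻¹ s}, fun Θ' h => ?_⟩
    rw [map_inv, map_inv, Perm.inv_eq_iff_eq, h a _ (Finset.mem_singleton_self _),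
      ← Perm.mul_apply, mul_inv_cancel, Perm.one_apply]
  | mul w w' ih ih' =>
    obtain ⟨T, hT⟩ := ih (Θ w' s)
    obtain ⟨T', hT'⟩ := ih' s
    refine ⟨T ∪ T', fun Θ' h => ?_⟩
    rw [map_mul, map_mul, Perm.mul_apply, Perm.mul_apply,
      hT' Θ' fun a x hx => h a x (Finset.mem_union_right T hx),
      hT Θ' fun a x hx => h a x (Finset.mem_union_left T' hx)]

theorem exists_finset_superset_invariant {F : Type*} [Group F] [Finite F] (j : F →* Perm Ω)
    (T : Finset Ω) : ∃ S ⊇ T, ∀ f x, j f x ∈ S ↔ x ∈ S := by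
  classical
  have := Fintype.ofFinite F
  have hmem (f x) (hx : x ∈ Finset.univ.biUnion fun f => T.image (j f)) :
      j f x ∈ Finset.univ.biUnion fun f => T.image (j f) := by
    simp only [Finset.mem_biUnion, Finset.mem_univ, true_and, Finset.mem_image] at hx ⊢
    obtain ⟨f', y, hy, rfl⟩ := hx
    exact ⟨f * f', y, hy, by rw [map_mul, Perm.mul_apply]⟩
  refine ⟨_, fun x hx => ?_, fun f x => ⟨fun h => ?_, hmem f x⟩⟩
  · exact Finset.mem_biUnion.2 ⟨1, Finset.mem_univ 1, Finset.mem_image.2 ⟨x, hx, by simp⟩⟩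
  · have := hmem f⁻¹ _ h
    rwa [← Perm.mul_apply, ← map_mul, inv_mul_cancel, map_one, Perm.one_apply] at this

theorem exists_perm_finset_apply_eq (t : Perm Ω) (S : Finset Ω) :
    ∃ σ : Perm S, ∀ x : S, t x ∈ S → (σ x : Ω) = t x := by
  classical
  obtain ⟨σ, hσ⟩ := Set.MapsTo.exists_equiv_extend_of_card_eq (f := fun x : S => t x)
    (s := {x | t x ∈ S}) (Fintype.card_coe S) (fun _ hx => hx)
    (t.injective.comp Subtype.val_injective).injOn
  exact ⟨σ, hσ⟩

variable {F : Type*} [Group F] [Finite F] (j : F →* Perm Ω) (t : Perm Ω)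

theorem exists_finite_group_freeGroup_hom (W : Finset (FreeGroup (Option F))) (Q : Finset Ω) :
    ∃ (S : Finset Ω) (ι : F →* Perm S × F) (τ : Perm S × F), Function.Injective ι ∧
      ∀ w ∈ W, FreeGroup.lift (fun o => o.elim τ ι) w = 1 →
        ∀ s ∈ Q, FreeGroup.lift (fun o => o.elim t j) w s = s := by
  classical
  choose T hT using exists_finset_freeGroup_hom_apply_eq
    (FreeGroup.lift fun o : Option F => o.elim t j)
  let T₀ : Finset Ω := W.biUnion fun w => Q.biUnion (T w)
  obtain ⟨S, hTS, hjS⟩ := exists_finset_superset_invariant j (T₀ ∪ T₀.image t)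
  obtain ⟨σ, hσ⟩ := exists_perm_finset_apply_eq t S
  let ι : F →* Perm S :=
    { toFun f := (j f).subtypePerm (hjS f)
      map_one' := by ext; simp
      map_mul' f f' := Perm.ext fun x => Subtype.ext (congrArg (· (x : Ω)) (map_mul j f f')) }
  refine ⟨S, ι.prod (MonoidHom.id F), (σ, 1), fun f f' h => congrArg Prod.snd h,
    fun w hw hw1 s hs => ?_⟩
  let Θ' : FreeGroup (Option F) →* Perm Ω :=
    ((Perm.ofSubtype (p := (· ∈ S))).comp (MonoidHom.fst (Perm S) F)).comp
      (FreeGroup.lift fun o : Option F => o.elim ((σ, 1) : Perm S × F) (ι.prod (MonoidHom.id F)))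
  have hΘ' : Θ' w s = s := by rw [MonoidHom.comp_apply, hw1, map_one, Perm.one_apply]
  rw [← hT w s Θ' fun o x hx => ?_, hΘ']
  have hxT : x ∈ T₀ := Finset.mem_biUnion.2 ⟨w, hw, Finset.mem_biUnion.2 ⟨s, hs, hx⟩⟩
  have hxS : x ∈ S := hTS (Finset.mem_union_left _ hxT)
  have htxS : t x ∈ S := hTS (Finset.mem_union_right _ (Finset.mem_image_of_mem t hxT))
  rcases o with _ | f
  · simpa [Θ', Perm.ofSubtype_apply_of_mem _ hxS] using hσ ⟨x, hxS⟩ htxS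
  · simp [Θ', Perm.ofSubtype_apply_of_mem _ hxS, ι]

end FiniteApproximation

namespace IsHallGroup

variable {G : Type u} [Group G]

theorem exists_extension (hG : IsHallGroup G) {A : Type u} {B : Type v} [Group A] [Group B]
    [Finite A] [Finite B] {ρ : A →* G} {ι : A →* B} (hρ : Function.Injective ρ)
    (hι : Function.Injective ι) : ∃ σ : B →* G, Function.Injective σ ∧ σ.comp ι = ρ := by
  let e : B ≃* Shrink.{u} B := (Shrink.mulEquiv.{u} (α := B)).symm
  obtain ⟨σ, hσ, hσι⟩ := hG.extension A (Shrink.{u} B) ρ (e.toMonoidHom.comp ι) hρ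
    (e.injective.comp hι)
  exact ⟨σ.comp e.toMonoidHom, hσ.comp e.injective, hσι⟩

theorem exists_freeGroup_hom (hG : IsHallGroup G) {F : Subgroup G} [Finite F] {Ω : Type v}
    (j : F →* Equiv.Perm Ω) (t : Equiv.Perm Ω) (W : Finset (FreeGroup (Option F)))
    (Q : Finset Ω) : ∃ Ψ : FreeGroup (Option F) →* G, (∀ f : F, Ψ (.of (some f)) = f) ∧
      ∀ w ∈ W, Ψ w = 1 → ∀ s ∈ Q, FreeGroup.lift (fun o => o.elim t j) w s = s := by
  obtain ⟨S, ι, τ, hι, hW⟩ := exists_finite_group_freeGroup_hom j t W Q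
  obtain ⟨σ, hσ, hσι⟩ := hG.exists_extension F.subtype_injective hι
  refine ⟨σ.comp (FreeGroup.lift fun o => o.elim τ ι), fun f => ?_, fun w hw hw1 => hW w hw ?_⟩
  · simpa using DFunLike.congr_fun hσι f
  · exact hσ (hw1.trans (map_one σ).symm)

end IsHallGroup

section GenericHom

open Filter Topology

/-- The inclusion of the isometry group into the group of all permutations. -/
def isometryPermHom (X : Type*) [PseudoMetricSpace X] : (X ≃ᵢ X) →* Equiv.Perm X where
  toFun := IsometryEquiv.toEquiv
  map_one' := rfl
  map_mul' _ _ := rfl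

namespace IsHallGroup

variable {G : Type u} [Group G] {U : Type v} [MetricSpace U] {F : Subgroup G} [Finite F]

theorem exists_orbitPseudometric (hG : IsHallGroup G) (θ : F →* (U ≃ᵢ U)) (φ : U ≃ᵢ U) {ι : Type*}
    (x : ι → U) {J : Set ι} (hJ : J.Finite) {δ : ℝ} (hδ : 0 < δ) :
    ∃ (g : Option F → G) (d : OrbitPseudometric G ι), (∀ f : F, g (some f) = f) ∧
      ∀ a b, ∀ i ∈ J, ∀ j ∈ J, |d.toDist (g a, i) (g b, j) -
        dist ((a.elim φ θ : U ≃ᵢ U) (x i)) ((b.elim φ θ : U ≃ᵢ U) (x j))| ≤ δ := by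
  classical
  let Θ : FreeGroup (Option F) →* (U ≃ᵢ U) := FreeGroup.lift fun o => o.elim φ θ
  have hΘ : FreeGroup.lift (fun o : Option F => o.elim (isometryPermHom U φ)
      ((isometryPermHom U).comp θ)) = (isometryPermHom U).comp Θ := by
    refine FreeGroup.ext_hom _ _ ?_
    rintro (_ | f) <;> simp [Θ]
  obtain ⟨W, hW⟩ := exists_orbitPseudometric_of_freeGroup Θ x hJ hδ
  obtain ⟨Ψ, hΨ, hΨW⟩ := hG.exists_freeGroup_hom ((isometryPermHom U).comp θ)
    (isometryPermHom U φ) W (hJ.toFinset.image x)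
  rw [hΘ] at hΨW
  obtain ⟨d, hd⟩ := hW Ψ fun w hw hw1 i hi =>
    hΨW w hw hw1 (x i) (Finset.mem_image_of_mem x (hJ.mem_toFinset.2 hi))
  exact ⟨fun o => Ψ (.of o), d, hΨ, by simpa only [Θ, FreeGroup.lift_apply_of] using hd⟩

variable [CompleteSpace U] [TopologicalSpace.SeparableSpace U]

theorem exists_hom_dist_le (hG : IsHallGroup G) (hU : HasExtensionProperty U)
    (θ : F →* (U ≃ᵢ U)) (φ : U ≃ᵢ U) (P : Finset U) {ε : ℝ} (hε : 0 < ε) :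
    ∃ (α : G →* (U ≃ᵢ U)) (g : G), (∀ f : F, ∀ x ∈ P, dist (α f x) (θ f x) ≤ ε) ∧
      ∀ x ∈ P, dist (α g x) (φ x) ≤ ε := by
  have := hG.countable
  obtain ⟨y₀⟩ := hU.nonempty
  -- The summand `ℕ` only serves to make the set of orbits infinite.
  obtain ⟨g, d, hg, hd⟩ := hG.exists_orbitPseudometric θ φ (ι := P ⊕ ℕ)
    (Sum.elim Subtype.val fun _ => y₀) (Set.finite_range Sum.inl) (half_pos hε)
  obtain ⟨α, y, hαy⟩ := d.exists_hom_isometryEquiv_dist_le hU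
    (s := fun z : Option F × P => (g z.1, .inl z.2))
    (u := fun z => (z.1.elim φ θ : U ≃ᵢ U) z.2) (half_pos hε)
    fun a b => (hd a.1 b.1 _ ⟨a.2, rfl⟩ _ ⟨b.2, rfl⟩).trans_lt (by linarith)
  have hy (x : P) : dist (y (.inl x)) x ≤ ε / 2 := by
    simpa [hg] using hαy (some 1, x)
  have hα (o : Option F) (x : P) : dist (α (g o) x) ((o.elim φ θ : U ≃ᵢ U) x) ≤ ε :=
    calc dist (α (g o) x) ((o.elim φ θ : U ≃ᵢ U) x)
      _ ≤ dist (α (g o) x) (α (g o) (y (.inl x))) +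
          dist (α (g o) (y (.inl x))) ((o.elim φ θ : U ≃ᵢ U) x) := dist_triangle _ _ _
      _ ≤ ε / 2 + ε / 2 := by
        rw [(α (g o)).dist_eq, dist_comm]
        exact add_le_add (hy x) (hαy (o, x))
      _ = ε := add_halves ε
  exact ⟨α, g none, fun f x hx => hg f ▸ hα (some f) ⟨x, hx⟩, fun x hx => hα none ⟨x, hx⟩⟩

theorem exists_hom_dist_le_of_finset (hG : IsHallGroup G) (hU : HasExtensionProperty U)
    (α₀ : G →* (U ≃ᵢ U)) (φ : U ≃ᵢ U) (T : Finset G) (P : Finset U) {ε : ℝ} (hε : 0 < ε) :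
    ∃ (α : G →* (U ≃ᵢ U)) (g : G), (∀ γ ∈ T, ∀ x ∈ P, dist (α γ x) (α₀ γ x) ≤ ε) ∧
      ∀ x ∈ P, dist (α g x) (φ x) ≤ ε := by
  have : Finite (Subgroup.closure (T : Set G)) :=
    hG.locallyFinite _ ((Subgroup.fg_iff _).2 ⟨T, rfl, T.finite_toSet⟩)
  obtain ⟨α, g, hα, hg⟩ := hG.exists_hom_dist_le hU
    (α₀.comp (Subgroup.closure (T : Set G)).subtype) φ P hε
  exact ⟨α, g, fun γ hγ => hα ⟨γ, Subgroup.subset_closure hγ⟩, hg⟩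

theorem dense_setOf_exists_mem (hG : IsHallGroup G) (hU : HasExtensionProperty U)
    {O : Set (U ≃ᵢ U)} (hO : IsOpen O) (hne : O.Nonempty) :
    Dense {α : G →* (U ≃ᵢ U) | ∃ g, α g ∈ O} := by
  classical
  intro α₀
  obtain ⟨φ, hφ⟩ := hne
  choose α g hα hg using fun s : Finset G × Finset U × ℕ =>
    hG.exists_hom_dist_le_of_finset hU α₀ φ s.1 s.2.1 (Nat.one_div_pos_of_nat (n := s.2.2))
  have hlim : Tendsto (fun s : Finset G × Finset U × ℕ => 1 / ((s.2.2 : ℝ) + 1)) atTop (𝓝 0) := by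
    simp only [← prod_atTop_atTop_eq]
    exact tendsto_one_div_add_atTop_nhds_zero_nat.comp (tendsto_snd.comp tendsto_snd)
  have hαlim : Tendsto α atTop (𝓝 α₀) := by
    refine tendsto_monoidHom_iff.2 fun γ => tendsto_isometryEquiv_iff.2 fun x => ?_
    refine tendsto_iff_dist_tendsto_zero.2 (squeeze_zero' (.of_forall fun _ => dist_nonneg) ?_ hlim)
    filter_upwards [eventually_ge_atTop ({γ}, {x}, 0)] with s hs
    exact hα s γ (hs.1 (Finset.mem_singleton_self γ)) x (hs.2.1 (Finset.mem_singleton_self x))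
  have hglim : Tendsto (fun s => α s (g s)) atTop (𝓝 φ) := by
    refine tendsto_isometryEquiv_iff.2 fun x => tendsto_iff_dist_tendsto_zero.2
      (squeeze_zero' (.of_forall fun _ => dist_nonneg) ?_ hlim)
    filter_upwards [eventually_ge_atTop (∅, {x}, 0)] with s hs
    exact hg s x (hs.2.1 (Finset.mem_singleton_self x))
  refine mem_closure_of_tendsto hαlim ?_
  filter_upwards [hglim.eventually (hO.mem_nhds hφ)] with s hs using ⟨g s, hs⟩

end IsHallGroup

theorem eventually_residual_denseRange_of_dense {G M : Type*} [Group G] [Group M]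
    [TopologicalSpace M] [SecondCountableTopology M]
    (h : ∀ O : Set M, IsOpen O → O.Nonempty → Dense {α : G →* M | ∃ g, α g ∈ O}) :
    ∀ᶠ α : G →* M in residual (G →* M), DenseRange α := by
  have hopen {O : Set M} (hO : IsOpen O) : IsOpen {α : G →* M | ∃ g, α g ∈ O} := by
    rw [Set.ofPred_exists]
    exact isOpen_iUnion fun g => hO.preimage (continuous_monoidHom_apply g)
  have hbasis : ∀ᶠ α : G →* M in residual (G →* M),
      ∀ O ∈ TopologicalSpace.countableBasis M, ∃ g, α g ∈ O :=
    (eventually_countable_ball (TopologicalSpace.countable_countableBasis M)).2 fun O hO =>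
      residual_of_dense_open (hopen (TopologicalSpace.isOpen_of_mem_countableBasis hO))
        (h O (TopologicalSpace.isOpen_of_mem_countableBasis hO)
          (TopologicalSpace.nonempty_of_mem_countableBasis hO))
  filter_upwards [hbasis] with α hα
  refine (TopologicalSpace.isBasis_countableBasis M).dense_iff.2 fun O hO _ => ?_
  obtain ⟨g, hg⟩ := hα O hO
  exact ⟨α g, hg, g, rfl⟩

theorem nonempty_topologicalClosure_range_continuousMulEquiv {G M : Type*} [Group G] [Group M]
    [TopologicalSpace M] [IsTopologicalGroup M] {α : G →* M} (hα : DenseRange α) :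
    Nonempty (α.range.topologicalClosure ≃ₜ* M) := by
  have htop : α.range.topologicalClosure = ⊤ := SetLike.coe_injective <| by
    rw [Subgroup.topologicalClosure_coe, MonoidHom.coe_range, hα.closure_range, Subgroup.coe_top]
  rw [htop]
  exact ⟨{ Subgroup.topEquiv with
    continuous_toFun := continuous_subtype_val
    continuous_invFun := continuous_id.subtype_mk _ }⟩

end GenericHom

theorem mainTheorem5 (G : Type u) [Group G] (hG : IsHallGroup G)
    (U : Type v) [MetricSpace U] (hU : IsUrysohnSpace U) :
    ∃ (H : Type v) (_ : Group H) (_ : TopologicalSpace H),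
      IsTopologicalGroup H ∧ PolishSpace H ∧
        ∀ᶠ α : G →* (U ≃ᵢ U) in residual (G →* (U ≃ᵢ U)),
          Nonempty (α.range.topologicalClosure ≃ₜ* H) := by
  have := hU.complete
  have := hU.separableSpace
  have := polishSpace_isometryEquiv U
  have hdense : ∀ᶠ α : G →* (U ≃ᵢ U) in residual (G →* (U ≃ᵢ U)), DenseRange α :=
    eventually_residual_denseRange_of_dense fun O hO hne =>
      hG.dense_setOf_exists_mem hU.hasExtensionProperty hO hne
  exact ⟨U ≃ᵢ U, inferInstance, inferInstance, inferInstance, inferInstance,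
    hdense.mono fun α hα => nonempty_topologicalClosure_range_continuousMulEquiv hα⟩
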